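/- For $m,n\ge 0$ let $G_{m,n}$ be the generalized Aztec diamond of order $m\times n$: its vertices are the pairs $(x,y)$ of integers with $1\le x\le 2m+1$, $1\le y\le 2n+1$ and $x+y$ odd, and $(x,y)$ is adjacent to $(x',y')$ if and only if $|x-x'|=|y-y'|=1$. Let $f(m,n)$ be the number of independent sets of $G_{m,n}$ (including the empty set) and $k(m,n)$ the number of its vertices. Let $T_{m,1}$ be the $2^m\times 2^{m+1}$ matrix with rows indexed by $v\in\{0,1\}^m$ and columns by $w\in\{0,1\}^{m+1}$, whose entry is $1$ if $v_iw_i=v_iw_{i+1}=0$ for all $1\le i\le m$, and $0$ otherwise, and let $T_m=T_{m,1}T_{m,1}^{\mathsf T}$. Let $B_{n,1}$ be the $2^n\times 2^n$ matrix with rows and columns indexed by $\{0,1\}^n$, whose entry at $(v,w)$ is $1$ if $v_iw_i=v_iw_{i+1}=0$ for all $i$, with indices taken modulo $n$, and $0$ otherwise, and let $B_n=B_{n,1}B_{n,1}^{\mathsf T}$ (the transfer matrix of the cylindrical generalized Aztec diamond). Let $\lambda_m$ and $\xi_n$ be the largest eigenvalues of $T_m$ and $B_n$. Then $T_m$ is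 symmetric, $f(m,n)=\mathbf 1^{\mathsf T}T_m^{\,n}\mathbf 1$ and $k(m,n)=2mn+m+n$ for all $m,n\ge 0$, the limits $$L=\lim_{m,n\to\infty}f(m,n)^{1/(mn)},\qquad \eta=\lim_{m,n\to\infty}f(m,n)^{1/k(m,n)}$$ exist (as double limits), and $\eta=\sqrt L$. For all integers $p\ge1$, $q\ge0$ and $k\ge1$, $$\left(\frac{\lambda_{p+2q}}{\lambda_{2q}}\right)^{1/p}\le L\le \xi_{2k}^{1/(2k)}.$$ In particular, with $p=2$, $q=4$, $k=5$, $$2.259132578\ldots=\left(\frac{\lambda_{10}}{\lambda_8}\right)^{1/2}\le L\le \xi_{10}^{1/10}=2.259154406\ldots,$$ and the entropy constant $\eta$ of the generalized Aztec diamond lattice satisfies $$1.503041110\ldots=\left(\frac{\lambda_{10}}{\lambda_8}\right)^{1/4}\le\eta\le \xi_{10}^{1/20}=1.503048371\ldots,$$ where the dots stand for the further digits of the decimal expansions of the four outer quantities. -/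

import Mathlib

namespace AztecDiamond

/-- The tensor product of two graphs: `(x, y)` is adjacent to `(x', y')` if and only if `x` is
adjacent to `x'` and `y` is adjacent to `y'`. For two paths this is `|x - x'| = |y - y'| = 1`. -/
def tensorProd {V W : Type*} (G : SimpleGraph V) (H : SimpleGraph W) : SimpleGraph (V × W) where
  Adj a b := G.Adj a.1 b.1 ∧ H.Adj a.2 b.2
  symm := ⟨fun _ _ h => ⟨h.1.symm, h.2.symm⟩⟩
  loopless := ⟨fun a h => G.irrefl (v := a.1) h.1⟩

/-- The vertices `(x, y)` of the tensor product of the paths with `2m+1` and `2n+1` vertices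
for which `x + y` is odd. (The coordinates start from `0` here; starting both from `1` does not
change the parity of the sum.) -/
abbrev Vertex (m n : ℕ) : Type :=
  {a : Fin (2 * m + 1) × Fin (2 * n + 1) // Odd ((a.1 : ℕ) + (a.2 : ℕ))}

/-- The generalized Aztec diamond of order `m × n`. -/
def diamond (m n : ℕ) : SimpleGraph (Vertex m n) :=
  (tensorProd (SimpleGraph.pathGraph (2 * m + 1)) (SimpleGraph.pathGraph (2 * n + 1))).comap
    Subtype.val

/-- The number of vertices of the generalized Aztec diamond of order `m × n`. -/
noncomputable def numVertices (m n : ℕ) : ℕ := Nat.card (Vertex m n)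

/-- The number of independent sets (the empty set included) of the generalized Aztec diamond of
order `m × n`. -/
noncomputable def numIndepSets (m n : ℕ) : ℕ :=
  Set.ncard {s : Set (Vertex m n) | (diamond m n).IsIndepSet s}

/-- The `2^m × 2^(m+1)` transfer matrix of the step from a column with `m` vertices to the next
column, which has `m + 1` vertices. The vertex `i` of the former is adjacent to the vertices `i`
and `i + 1` of the latter, and the entry is `1` if no two chosen vertices are adjacent. -/
def stepMatrix (m : ℕ) : Matrix (Fin m → Bool) (Fin (m + 1) → Bool) ℝ :=
  Matrix.of fun v w =>
    if ∀ (i : Fin m) (j : Fin (m + 1)),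
      ((j : ℕ) = i ∨ (j : ℕ) = i + 1) → ¬(v i = true ∧ w j = true) then 1 else 0

/-- The transfer matrix of the generalized Aztec diamond (two steps). -/
noncomputable def transferMatrix (m : ℕ) : Matrix (Fin m → Bool) (Fin m → Bool) ℝ :=
  stepMatrix m * (stepMatrix m).transpose

/-- The `2^n × 2^n` transfer matrix of the step from one row to the next one in the cylindrical
generalized Aztec diamond whose cyclic rows have `n` vertices each. The vertex `i` of the former
row is adjacent to the vertices `i` and `i + 1` (modulo `n`) of the latter. -/
def cylStepMatrix (n : ℕ) : Matrix (Fin n → Bool) (Fin n → Bool) ℝ :=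
  Matrix.of fun v w =>
    if ∀ i j : Fin n,
      ((j : ℕ) = i ∨ (j : ℕ) = (i + 1) % n) → ¬(v i = true ∧ w j = true) then 1 else 0

/-- The transfer matrix of the cylindrical generalized Aztec diamond (two steps). -/
noncomputable def cylTransferMatrix (n : ℕ) : Matrix (Fin n → Bool) (Fin n → Bool) ℝ :=
  cylStepMatrix n * (cylStepMatrix n).transpose

/-- The largest real eigenvalue of a real square matrix. The next fact shows that the supremum is
attained for the matrices that matter here. -/
noncomputable def largestEigenvalue {ι : Type*} [Fintype ι] [DecidableEq ι]
    (A : Matrix ι ι ℝ) : ℝ :=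
  sSup {μ : ℝ | Module.End.HasEigenvalue (Matrix.toLin' A) μ}

theorem isGreatest_largestEigenvalue {ι : Type*} [Fintype ι] [DecidableEq ι] [Nonempty ι]
    (A : Matrix ι ι ℝ) (hA : A.IsSymm) :
    IsGreatest {μ : ℝ | Module.End.HasEigenvalue (Matrix.toLin' A) μ} (largestEigenvalue A) := by
  have hfin : {μ : ℝ | Module.End.HasEigenvalue (Matrix.toLin' A) μ}.Finite :=
    Module.End.finite_hasEigenvalue _
  have hH : A.IsHermitian := by
    rw [Matrix.IsHermitian, Matrix.conjTranspose_eq_transpose_of_trivial]; exact hA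
  have hne : {μ : ℝ | Module.End.HasEigenvalue (Matrix.toLin' A) μ}.Nonempty := by
    obtain ⟨i⟩ := (inferInstance : Nonempty ι)
    refine ⟨hH.eigenvalues i, ?_⟩
    have h := hH.eigenvalues_mem_spectrum_real i
    rw [← Matrix.spectrum_toLin'] at h
    exact Module.End.hasEigenvalue_iff_mem_spectrum.mpr h
  exact ⟨hne.csSup_mem hfin, fun μ hμ => le_csSup hfin.bddAbove hμ⟩

/-- `λ_m`, the largest eigenvalue of the transfer matrix `T_m`. -/
noncomputable def lam (m : ℕ) : ℝ := largestEigenvalue (transferMatrix m)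

/-- `ξ_n`, the largest eigenvalue of the cylindrical transfer matrix `B_n`. -/
noncomputable def xi (n : ℕ) : ℝ := largestEigenvalue (cylTransferMatrix n)

end AztecDiamond

/-! Write `T = transferMatrix m`. Being `S * Sᵀ`, it is positive semidefinite with nonnegative
entries, and the sum of the entries of `T ^ n` is f(m,n). Everything follows from two spectral
inequalities, λ^n ≤ tr T^n and xᵀTⁿx ≤ λ^n xᵀx, combined with double counting.

Existence of the limits: λ_m^n ≤ tr T^n ≤ f(m,n) ≤ 2^m λ_m^n, so log f(m,n)/(mn) lies within log 2/n
above log λ_m/m. Since f(m,n) = f(n,m) (`numIndepSets_comm`), the sequence log λ_m/m is Cauchy. With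
its limit l, L = exp l, and η = exp(l/2) because mn/k(m,n) → 1/2.

Lower bound: the Rayleigh quotient at T^q·1 gives f(n,p+2q) ≤ λ_n^p f(n,2q) (`numIndepSets_add_le`).
After transposition the two counts grow in n like λ_{p+2q}^n and λ_{2q}^n; take n-th roots.

Upper bound: tr T_m^k counts independent sets on a cylinder. Read in the other direction this count
is 1ᵀB_k^m 1, hence λ_m^k ≤ ξ_k^m 2^k (`lam_pow_le_xi`).

Numerics: Collatz–Wielandt quotients of explicit positive integer vectors, evaluated exactly by the
kernel, bracket λ_10, λ_8 and ξ_10. -/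

namespace AztecDiamond

/-! ### Spectral inequalities for symmetric and positive semidefinite matrices. -/

section Spectral

open Matrix

theorem posSemidef_mul_transpose {ι κ : Type*} [Fintype ι] [Fintype κ] (S : Matrix ι κ ℝ) :
    (S * Sᵀ).PosSemidef := by
  simpa using posSemidef_self_mul_conjTranspose S

variable {ι : Type*} [Fintype ι] [DecidableEq ι]

theorem eigenvalue_le_largestEigenvalue [Nonempty ι] {A : Matrix ι ι ℝ} (hA : A.IsHermitian)
    (i : ι) : hA.eigenvalues i ≤ largestEigenvalue A := by
  refine (isGreatest_largestEigenvalue A ?_).2 ?_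
  · rwa [IsHermitian, conjTranspose_eq_transpose_of_trivial] at hA
  · have h := hA.eigenvalues_mem_spectrum_real i
    rw [← Matrix.spectrum_toLin'] at h
    exact Module.End.hasEigenvalue_iff_mem_spectrum.mpr h

theorem exists_eigenvalue_eq_largestEigenvalue [Nonempty ι] {A : Matrix ι ι ℝ}
    (hA : A.IsHermitian) : ∃ i, hA.eigenvalues i = largestEigenvalue A := by
  have h := (isGreatest_largestEigenvalue A (by
    rwa [IsHermitian, conjTranspose_eq_transpose_of_trivial] at hA)).1
  have h' := Module.End.hasEigenvalue_iff_mem_spectrum.mp h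
  rw [Matrix.spectrum_toLin', hA.spectrum_real_eq_range_eigenvalues] at h'
  exact h'

/-- A real symmetric matrix is orthogonally diagonalizable. -/
theorem exists_orthogonal_pow_eq {A : Matrix ι ι ℝ} (hA : A.IsHermitian) :
    ∃ U : Matrix ι ι ℝ, U * Uᵀ = 1 ∧ Uᵀ * U = 1 ∧
      ∀ n : ℕ, A ^ n = U * diagonal (fun i => hA.eigenvalues i ^ n) * Uᵀ := by
  let U : Matrix ι ι ℝ := hA.eigenvectorUnitary
  have hs : star U = Uᵀ := by
    rw [star_eq_conjTranspose, conjTranspose_eq_transpose_of_trivial]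
  have h1 : U * Uᵀ = 1 := by rw [← hs]; exact Unitary.mul_star_self_of_mem hA.eigenvectorUnitary.2
  have h2 : Uᵀ * U = 1 := by rw [← hs]; exact Unitary.star_mul_self_of_mem hA.eigenvectorUnitary.2
  refine ⟨U, h1, h2, fun n => ?_⟩
  have hA1 : A = U * diagonal hA.eigenvalues * Uᵀ := by
    rw [← hs]
    simpa [Unitary.conjStarAlgAut_apply] using hA.spectral_theorem
  induction n with
  | zero => simp [h1]
  | succ n ih =>
    rw [pow_succ, ih]
    nth_rw 2 [hA1]
    calc U * diagonal (fun i => hA.eigenvalues i ^ n) * Uᵀ * (U * diagonal hA.eigenvalues * Uᵀ)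
        = U * diagonal (fun i => hA.eigenvalues i ^ n) * (Uᵀ * U) *
            diagonal hA.eigenvalues * Uᵀ := by simp only [Matrix.mul_assoc]
      _ = _ := by
        rw [h2, Matrix.mul_one, Matrix.mul_assoc U, diagonal_mul_diagonal]
        simp only [pow_succ]

theorem largestEigenvalue_pow_le_trace [Nonempty ι] {A : Matrix ι ι ℝ} (hA : A.PosSemidef)
    (n : ℕ) : largestEigenvalue A ^ n ≤ (A ^ n).trace := by
  obtain ⟨U, -, h2, h⟩ := exists_orthogonal_pow_eq hA.1
  obtain ⟨i, hi⟩ := exists_eigenvalue_eq_largestEigenvalue hA.1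
  rw [h, Matrix.mul_assoc, trace_mul_comm, Matrix.mul_assoc, h2, Matrix.mul_one, trace_diagonal,
    ← hi]
  exact Finset.single_le_sum (f := fun i => hA.1.eigenvalues i ^ n)
    (fun j _ => pow_nonneg (hA.eigenvalues_nonneg j) n) (Finset.mem_univ i)

/-- In an orthonormal eigenbasis the form is a sum of squares weighted by powers of eigenvalues.
Nonnegativity of the eigenvalues lets the n-th powers be compared for every parity of n. -/
theorem dotProduct_pow_mulVec_le [Nonempty ι] {A : Matrix ι ι ℝ} (hA : A.PosSemidef)
    (n : ℕ) (x : ι → ℝ) :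
    x ⬝ᵥ (A ^ n *ᵥ x) ≤ largestEigenvalue A ^ n * (x ⬝ᵥ x) := by
  obtain ⟨U, h1, -, h⟩ := exists_orthogonal_pow_eq hA.1
  set y := Uᵀ *ᵥ x with hy
  have e1 : x ⬝ᵥ (A ^ n *ᵥ x) = ∑ i, hA.1.eigenvalues i ^ n * (y i * y i) := by
    rw [h, Matrix.mul_assoc, ← mulVec_mulVec, ← mulVec_mulVec, dotProduct_mulVec,
      ← mulVec_transpose, ← hy, dotProduct]
    refine Finset.sum_congr rfl fun i _ => ?_
    rw [mulVec_diagonal]; ring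
  have e2 : x ⬝ᵥ x = ∑ i, y i * y i := by
    change _ = y ⬝ᵥ y
    rw [hy, dotProduct_mulVec, vecMul_transpose, mulVec_mulVec, h1, one_mulVec]
  rw [e1, e2, Finset.mul_sum]
  refine Finset.sum_le_sum fun i _ => ?_
  exact mul_le_mul_of_nonneg_right (pow_le_pow_left₀ (hA.eigenvalues_nonneg i)
    (eigenvalue_le_largestEigenvalue hA.1 i) n) (mul_self_nonneg _)

theorem largestEigenvalue_nonneg [Nonempty ι] {A : Matrix ι ι ℝ} (hA : A.PosSemidef) :
    0 ≤ largestEigenvalue A := by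
  obtain ⟨i, hi⟩ := exists_eigenvalue_eq_largestEigenvalue hA.1
  exact hi ▸ hA.eigenvalues_nonneg i

/-- The lower Collatz–Wielandt bound. -/
theorem le_largestEigenvalue_of_le_mulVec [Nonempty ι] {A : Matrix ι ι ℝ} (hA : A.PosSemidef)
    {x : ι → ℝ} {c : ℝ} (hx : ∀ i, 0 < x i) (h : ∀ i, c * x i ≤ (A *ᵥ x) i) :
    c ≤ largestEigenvalue A := by
  -- The Rayleigh quotient of `x` is a weighted mean of the quotients (Ax)_i / x_i with weights
  -- x_i².
  have h1 := dotProduct_pow_mulVec_le hA 1 x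
  rw [pow_one, pow_one] at h1
  have h2 : c * (x ⬝ᵥ x) ≤ x ⬝ᵥ (A *ᵥ x) := by
    rw [dotProduct, dotProduct, Finset.mul_sum]
    refine Finset.sum_le_sum fun i _ => ?_
    nlinarith [mul_le_mul_of_nonneg_left (h i) (hx i).le]
  have h3 : 0 < x ⬝ᵥ x :=
    Finset.sum_pos (fun i _ => mul_pos (hx i) (hx i)) Finset.univ_nonempty
  exact le_of_mul_le_mul_right (h2.trans h1) h3

/-- The upper Collatz–Wielandt bound. -/
theorem largestEigenvalue_le_of_mulVec_le [Nonempty ι] {A : Matrix ι ι ℝ} (hA : A.IsSymm)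
    (h0 : ∀ i j, 0 ≤ A i j) {x : ι → ℝ} {c : ℝ} (hx : ∀ i, 0 < x i)
    (h : ∀ i, (A *ᵥ x) i ≤ c * x i) : largestEigenvalue A ≤ c := by
  obtain ⟨v, hv⟩ := (isGreatest_largestEigenvalue A hA).1.exists_hasEigenvector
  have hv1 : A *ᵥ v = largestEigenvalue A • v := hv.apply_eq_smul
  -- Scale `x` to the least multiple `t * x` dominating |v|. At an index of contact, the eigenvalue
  -- equation for `v` can be compared with the bound on `A *ᵥ x`.
  obtain ⟨i, -, hi⟩ := Finset.exists_max_image Finset.univ (fun i => |v i| / x i)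
    Finset.univ_nonempty
  set t := |v i| / x i with ht
  have hvt : ∀ j, |v j| ≤ t * x j := fun j => by
    have := hi j (Finset.mem_univ j)
    rwa [div_le_iff₀ (hx j)] at this
  have ht0 : 0 < t := by
    obtain ⟨j, hj⟩ := Function.ne_iff.mp hv.2
    refine lt_of_lt_of_le (div_pos (abs_pos.mpr hj) (hx j)) (hi j (Finset.mem_univ j))
  have hvi : |v i| = t * x i := by rw [ht, div_mul_cancel₀ _ (hx i).ne']
  have h1 : largestEigenvalue A * |v i| ≤ c * |v i| := by
    calc largestEigenvalue A * |v i| ≤ |largestEigenvalue A * v i| := by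
          rw [abs_mul]; exact mul_le_mul_of_nonneg_right (le_abs_self _) (abs_nonneg _)
      _ = |∑ j, A i j * v j| := by
          have := congrFun hv1 i
          rw [Pi.smul_apply, smul_eq_mul] at this
          rw [← this]; rfl
      _ ≤ ∑ j, |A i j * v j| := Finset.abs_sum_le_sum_abs _ _
      _ ≤ ∑ j, t * (A i j * x j) := by
          refine Finset.sum_le_sum fun j _ => ?_
          rw [abs_mul, abs_of_nonneg (h0 i j)]
          nlinarith [mul_le_mul_of_nonneg_left (hvt j) (h0 i j)]
      _ = t * (A *ᵥ x) i := by rw [← Finset.mul_sum]; rfl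
      _ ≤ t * (c * x i) := mul_le_mul_of_nonneg_left (h i) ht0.le
      _ = c * |v i| := by rw [hvi]; ring
  exact le_of_mul_le_mul_right h1 (hvi ▸ mul_pos ht0 (hx i))

end Spectral

/-! ### Matrix powers and traces as counts of open and closed walks. -/

section Paths

open Matrix

/-- An entry of the product counts the intermediate states, and distributing the product over these
sums chooses one intermediate state per step. The endpoints `s`, `t` are left arbitrary so that both
open and closed walks are covered. -/
theorem sum_prod_mul_transpose {ι κ : Type*} [Fintype κ] (R : ι → κ → Prop)
    [∀ u k, Decidable (R u k)] {α β : Type*} [Fintype α] [Fintype β] [DecidableEq β]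
    (s t : α → β → ι) :
    ∑ p : α, ∏ j : β, ((Matrix.of fun u k => if R u k then (1 : ℝ) else 0) *
      (Matrix.of fun u k => if R u k then (1 : ℝ) else 0)ᵀ) (s p j) (t p j) =
    (Nat.card {a : α × (β → κ) // ∀ j, R (s a.1 j) (a.2 j) ∧ R (t a.1 j) (a.2 j)} : ℝ) := by
  classical
  simp only [Matrix.mul_apply, Matrix.transpose_apply, Matrix.of_apply, ← ite_and, mul_ite, mul_one,
    mul_zero]
  simp only [Finset.prod_univ_sum, Fintype.piFinset_univ, Finset.prod_ite_zero,
    Finset.prod_const_one]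
  rw [← Fintype.sum_prod_type', Finset.sum_boole, Nat.card_eq_fintype_card, Fintype.card_subtype]
  simp [and_comm]

variable {ι κ : Type*} [Fintype ι] [DecidableEq ι] [Fintype κ]

theorem sum_pow_apply (M : Matrix ι ι ℝ) (n : ℕ) (u : ι) :
    ∑ v, (M ^ n) u v =
      ∑ q : Fin n → ι, ∏ j : Fin n, M ((Fin.cons u q : Fin (n + 1) → ι) j.castSucc) (q j) := by
  induction n generalizing u with
  | zero => simp [Matrix.one_apply]
  | succ n ih =>
    simp only [pow_succ', Matrix.mul_apply]
    rw [Finset.sum_comm, ← (Fin.consEquiv fun _ => ι).sum_comp, Fintype.sum_prod_type]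
    refine Finset.sum_congr rfl fun w _ => ?_
    rw [← Finset.mul_sum, ih, Finset.mul_sum]
    refine Finset.sum_congr rfl fun q _ => ?_
    simp [Fin.prod_univ_succ, Fin.consEquiv]

theorem sum_sum_pow (M : Matrix ι ι ℝ) (n : ℕ) :
    ∑ u, ∑ v, (M ^ n) u v =
      ∑ p : Fin (n + 1) → ι, ∏ j : Fin n, M (p j.castSucc) (p j.succ) := by
  rw [← (Fin.consEquiv fun _ => ι).sum_comp, Fintype.sum_prod_type]
  refine Finset.sum_congr rfl fun u _ => ?_
  rw [sum_pow_apply]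
  simp [Fin.consEquiv]

theorem pow_succ_apply (M : Matrix ι ι ℝ) (n : ℕ) (u v : ι) :
    (M ^ (n + 1)) u v = ∑ q : Fin n → ι, ∏ j : Fin (n + 1),
      M ((Fin.cons u q : Fin (n + 1) → ι) j) ((Fin.snoc q v : Fin (n + 1) → ι) j) := by
  induction n generalizing u with
  | zero => simp [Fin.snoc]
  | succ n ih =>
    rw [pow_succ', Matrix.mul_apply, ← (Fin.consEquiv fun _ => ι).sum_comp, Fintype.sum_prod_type]
    refine Finset.sum_congr rfl fun w _ => ?_
    rw [ih, Finset.mul_sum]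
    refine Finset.sum_congr rfl fun q _ => ?_
    simp [Fin.prod_univ_succ (n := n + 1), Fin.consEquiv, ← Fin.cons_snoc_eq_snoc_cons]

/-- The addition `j + 1` in `Fin (n + 1)` wraps around, which closes the walk. -/
theorem trace_pow_succ (M : Matrix ι ι ℝ) (n : ℕ) :
    (M ^ (n + 1)).trace = ∑ p : Fin (n + 1) → ι, ∏ j, M (p j) (p (j + 1)) := by
  rw [← (Fin.consEquiv fun _ => ι).sum_comp, Fintype.sum_prod_type, Matrix.trace]
  refine Finset.sum_congr rfl fun u _ => ?_
  rw [diag_apply, pow_succ_apply]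
  refine Finset.sum_congr rfl fun q _ => Finset.prod_congr rfl fun j _ => ?_
  congr 1
  refine Fin.lastCases ?_ (fun i => ?_) j
  · simp [Fin.consEquiv]
  · simp [Fin.consEquiv, Fin.coeSucc_eq_succ]

variable (R : ι → κ → Prop) [∀ u k, Decidable (R u k)]

/-- The pairs `(p, q)` of sequences of states that are compatible with the walk
`p 0, q 0, p 1, q 1, …, q (n - 1), p n`. -/
abbrev OpenWalk (R : ι → κ → Prop) (n : ℕ) : Type _ :=
  {a : (Fin (n + 1) → ι) × (Fin n → κ) //
    ∀ j, R (a.1 j.castSucc) (a.2 j) ∧ R (a.1 j.succ) (a.2 j)}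

/-- The pairs `(p, q)` of cyclic sequences of states that are compatible with the closed walk
`p 0, q 0, p 1, q 1, …, p n, q n, p 0`. -/
abbrev ClosedWalk (R : ι → κ → Prop) (n : ℕ) : Type _ :=
  {a : (Fin (n + 1) → ι) × (Fin (n + 1) → κ) // ∀ j, R (a.1 j) (a.2 j) ∧ R (a.1 (j + 1)) (a.2 j)}

theorem sum_sum_mul_transpose_pow (n : ℕ) :
    ∑ u, ∑ v, (((Matrix.of fun u k => if R u k then (1 : ℝ) else 0) *
      (Matrix.of fun u k => if R u k then (1 : ℝ) else 0)ᵀ) ^ n) u v =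
    (Nat.card (OpenWalk R n) : ℝ) := by
  rw [sum_sum_pow, sum_prod_mul_transpose]

theorem trace_mul_transpose_pow (n : ℕ) :
    (((Matrix.of fun u k => if R u k then (1 : ℝ) else 0) *
      (Matrix.of fun u k => if R u k then (1 : ℝ) else 0)ᵀ) ^ (n + 1)).trace =
    (Nat.card (ClosedWalk R n) : ℝ) := by
  rw [trace_pow_succ, sum_prod_mul_transpose]

end Paths

/-! ### Independent sets as walks, and the exchange of the two directions. -/

section Counting

/-- The compatibility of two consecutive columns with `m` and `m + 1` vertices. -/
abbrev StepRel (m : ℕ) (v : Fin m → Bool) (w : Fin (m + 1) → Bool) : Prop :=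
  ∀ (i : Fin m) (j : Fin (m + 1)),
    ((j : ℕ) = i ∨ (j : ℕ) = i + 1) → ¬(v i = true ∧ w j = true)

/-- The compatibility of two consecutive cyclic rows with `n` vertices. -/
abbrev CylStepRel (n : ℕ) (v w : Fin n → Bool) : Prop :=
  ∀ i j : Fin n, ((j : ℕ) = i ∨ (j : ℕ) = (i + 1) % n) → ¬(v i = true ∧ w j = true)

theorem transferMatrix_isSymm (m : ℕ) : (transferMatrix m).IsSymm := by
  simp [Matrix.IsSymm, transferMatrix, Matrix.transpose_mul]

theorem cylTransferMatrix_isSymm (n : ℕ) : (cylTransferMatrix n).IsSymm := by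
  simp [Matrix.IsSymm, cylTransferMatrix, Matrix.transpose_mul]

theorem sum_transferMatrix_pow (m n : ℕ) :
    ∑ u, ∑ v, (transferMatrix m ^ n) u v = (Nat.card (OpenWalk (StepRel m) n) : ℝ) :=
  sum_sum_mul_transpose_pow (StepRel m) n

theorem stepRel_iff {m : ℕ} {v : Fin m → Bool} {w : Fin (m + 1) → Bool} :
    StepRel m v w ↔
      ∀ i, ¬(v i = true ∧ w i.castSucc = true) ∧ ¬(v i = true ∧ w i.succ = true) := by
  refine ⟨fun h i => ⟨h i _ (.inl rfl), h i _ (.inr rfl)⟩, fun h i j hj => ?_⟩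
  rcases hj with hj | hj
  · rw [show j = i.castSucc from Fin.ext hj]; exact (h i).1
  · rw [show j = i.succ from Fin.ext hj]; exact (h i).2

theorem cylStepRel_iff {n : ℕ} {v w : Fin (n + 1) → Bool} :
    CylStepRel (n + 1) v w ↔
      ∀ i, ¬(v i = true ∧ w i = true) ∧ ¬(v i = true ∧ w (i + 1) = true) := by
  have hv : ∀ i : Fin (n + 1), ((i + 1 : Fin (n + 1)) : ℕ) = (i + 1) % (n + 1) := fun i => by
    simp [Fin.val_add]
  refine ⟨fun h i => ⟨h i _ (.inl rfl), h i _ (.inr (hv i))⟩, fun h i j hj => ?_⟩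
  rcases hj with hj | hj
  · rw [show j = i from Fin.ext hj]; exact (h i).1
  · rw [show j = i + 1 from Fin.ext (hj.trans (hv i).symm)]; exact (h i).2

/-- Transposing the array of a closed walk of the transfer matrix of the diamond gives a walk of
the cylindrical transfer matrix. -/
def closedWalkEquiv (m n : ℕ) :
    ClosedWalk (StepRel m) n ≃ OpenWalk (CylStepRel (n + 1)) m :=
  Equiv.subtypeEquiv
    -- The wide columns have `m + 1` entries, so they supply the `m + 1` states at the ends of the
    -- steps; the narrow ones supply the `m` intermediate states.
    { toFun := fun a => (fun i j => a.2 j i, fun i j => a.1 j i)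
      invFun := fun a => (fun j i => a.2 i j, fun j i => a.1 i j)
      left_inv := fun _ => rfl
      right_inv := fun _ => rfl } (by
    rintro ⟨p, q⟩
    simp only [stepRel_iff, cylStepRel_iff, Equiv.coe_fn_mk]
    constructor
    · intro h i
      refine ⟨fun j => ⟨?_, ?_⟩, fun j => ⟨?_, ?_⟩⟩ <;> rw [and_comm]
      exacts [((h j).1 i).1, ((h j).2 i).1, ((h j).1 i).2, ((h j).2 i).2]
    · intro h j
      refine ⟨fun i => ⟨?_, ?_⟩, fun i => ⟨?_, ?_⟩⟩ <;> rw [and_comm]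
      exacts [((h i).1 j).1, ((h i).2 j).1, ((h i).1 j).2, ((h i).2 j).2])

/-- Both sides count the independent sets of the same cylindrical graph, once around the cylinder
and once along its axis. -/
theorem trace_transferMatrix_pow (m n : ℕ) :
    (transferMatrix m ^ (n + 1)).trace =
      ∑ u, ∑ v, (cylTransferMatrix (n + 1) ^ m) u v := by
  have h1 : (transferMatrix m ^ (n + 1)).trace = (Nat.card (ClosedWalk (StepRel m) n) : ℝ) :=
    trace_mul_transpose_pow (StepRel m) n
  have h2 : ∑ u, ∑ v, (cylTransferMatrix (n + 1) ^ m) u v =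
      (Nat.card (OpenWalk (CylStepRel (n + 1)) m) : ℝ) :=
    sum_sum_mul_transpose_pow (CylStepRel (n + 1)) m
  rw [h1, h2, Nat.card_congr (closedWalkEquiv m n)]

/-- Transposing the array of a walk exchanges the two orders of the diamond. -/
def openWalkEquiv (m n : ℕ) : OpenWalk (StepRel m) n ≃ OpenWalk (StepRel n) m :=
  Equiv.subtypeEquiv
    { toFun := fun a => (fun i j => a.2 j i, fun i j => a.1 j i)
      invFun := fun a => (fun j i => a.2 i j, fun j i => a.1 i j)
      left_inv := fun _ => rfl
      right_inv := fun _ => rfl } (by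
    rintro ⟨p, q⟩
    simp only [stepRel_iff, Equiv.coe_fn_mk]
    constructor
    · intro h i
      refine ⟨fun j => ⟨?_, ?_⟩, fun j => ⟨?_, ?_⟩⟩ <;> rw [and_comm]
      exacts [((h j).1 i).1, ((h j).2 i).1, ((h j).1 i).2, ((h j).2 i).2]
    · intro h j
      refine ⟨fun i => ⟨?_, ?_⟩, fun i => ⟨?_, ?_⟩⟩ <;> rw [and_comm]
      exacts [((h i).1 j).1, ((h i).2 j).1, ((h i).1 j).2, ((h i).2 j).2])

/-- The vertices of the diamond by columns: the columns with an even index and those with an odd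
index alternate. -/
def vertexEquiv (m n : ℕ) :
    (Fin (n + 1) × Fin m) ⊕ (Fin n × Fin (m + 1)) ≃ Vertex m n where
  toFun := Sum.elim
    (fun a => ⟨(⟨2 * a.2 + 1, by omega⟩, ⟨2 * a.1, by omega⟩), ⟨a.2 + a.1, by simp; ring⟩⟩)
    (fun a => ⟨(⟨2 * a.2, by omega⟩, ⟨2 * a.1 + 1, by omega⟩), ⟨a.2 + a.1, by simp; ring⟩⟩)
  invFun a :=
    if h : (a.1.2 : ℕ) % 2 = 0 then
      -- An even second coordinate forces an odd first one, which is therefore less than `2 * m`.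
      Sum.inl (⟨a.1.2 / 2, by omega⟩, ⟨a.1.1 / 2, by
        have := a.2; rw [Nat.odd_iff] at this; omega⟩)
    else
      Sum.inr (⟨a.1.2 / 2, by omega⟩, ⟨a.1.1 / 2, by omega⟩)
  left_inv := by
    rintro (⟨j, i⟩ | ⟨j, i⟩)
    · simp; ext; simp; omega
    · simp [Nat.add_mod]; ext; simp; omega
  right_inv := by
    rintro ⟨⟨x, y⟩, h⟩
    have h' := h
    simp only [Nat.odd_iff] at h'
    by_cases hy : (y : ℕ) % 2 = 0
    · simp only [hy, dite_true, Sum.elim_inl]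
      refine Subtype.ext (Prod.ext (Fin.ext ?_) (Fin.ext ?_)) <;> simp <;> omega
    · simp only [hy, dite_false, Sum.elim_inr]
      refine Subtype.ext (Prod.ext (Fin.ext ?_) (Fin.ext ?_)) <;> simp <;> omega

theorem numVertices_eq (m n : ℕ) : numVertices m n = 2 * m * n + m + n := by
  rw [numVertices, ← Nat.card_congr (vertexEquiv m n)]
  simp
  ring

theorem diamond_adj {m n : ℕ} (a b : Vertex m n) :
    (diamond m n).Adj a b ↔
      (((a.1.1 : ℕ) + 1 = b.1.1 ∨ (b.1.1 : ℕ) + 1 = a.1.1) ∧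
        ((a.1.2 : ℕ) + 1 = b.1.2 ∨ (b.1.2 : ℕ) + 1 = a.1.2)) := by
  simp [diamond, tensorProd, SimpleGraph.pathGraph_adj]

/-- The set of vertices of the diamond that is given by its columns. -/
noncomputable def columnsEquiv (m n : ℕ) :
    (Fin (n + 1) → Fin m → Bool) × (Fin n → Fin (m + 1) → Bool) ≃ Set (Vertex m n) :=
  (((Equiv.curry _ _ _).symm.prodCongr (Equiv.curry _ _ _).symm).trans
    (Equiv.sumArrowEquivProdArrow _ _ _).symm).trans
    ((vertexEquiv m n).arrowCongr Equiv.propEquivBool.symm)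

theorem vertexEquiv_inl_mem_columnsEquiv {m n : ℕ}
    (a : (Fin (n + 1) → Fin m → Bool) × (Fin n → Fin (m + 1) → Bool)) (j : Fin (n + 1))
    (i : Fin m) : vertexEquiv m n (.inl (j, i)) ∈ columnsEquiv m n a ↔ a.1 j i = true := by
  change Equiv.propEquivBool.symm _ ↔ _
  simp [Equiv.sumArrowEquivProdArrow, Equiv.propEquivBool]

theorem vertexEquiv_inr_mem_columnsEquiv {m n : ℕ}
    (a : (Fin (n + 1) → Fin m → Bool) × (Fin n → Fin (m + 1) → Bool)) (j : Fin n)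
    (i : Fin (m + 1)) : vertexEquiv m n (.inr (j, i)) ∈ columnsEquiv m n a ↔ a.2 j i = true := by
  change Equiv.propEquivBool.symm _ ↔ _
  simp [Equiv.sumArrowEquivProdArrow, Equiv.propEquivBool]

theorem diamond_adj_inl_inr {m n : ℕ} (j : Fin (n + 1)) (i : Fin m) (l : Fin n)
    (k : Fin (m + 1)) :
    (diamond m n).Adj (vertexEquiv m n (.inl (j, i))) (vertexEquiv m n (.inr (l, k))) ↔
      ((k : ℕ) = i ∨ (k : ℕ) = i + 1) ∧ (j = l.castSucc ∨ j = l.succ) := by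
  rw [diamond_adj, Fin.ext_iff, Fin.ext_iff]
  simp [vertexEquiv]
  omega

/-- An edge changes the parity of the second coordinate, so the graph is bipartite between the two
kinds of columns and only mixed pairs impose a condition. -/
theorem isIndepSet_columnsEquiv_iff {m n : ℕ}
    (a : (Fin (n + 1) → Fin m → Bool) × (Fin n → Fin (m + 1) → Bool)) :
    (diamond m n).IsIndepSet (columnsEquiv m n a) ↔
      ∀ j, StepRel m (a.1 j.castSucc) (a.2 j) ∧ StepRel m (a.1 j.succ) (a.2 j) := by
  have key : (diamond m n).IsIndepSet (columnsEquiv m n a) ↔ ∀ j i l k,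
      (diamond m n).Adj (vertexEquiv m n (.inl (j, i))) (vertexEquiv m n (.inr (l, k))) →
        ¬(a.1 j i = true ∧ a.2 l k = true) := by
    constructor
    · rintro h j i l k hadj ⟨h1, h2⟩
      exact h ((vertexEquiv_inl_mem_columnsEquiv a j i).2 h1)
        ((vertexEquiv_inr_mem_columnsEquiv a l k).2 h2) hadj.ne hadj
    · intro h u hu v hv _ hadj
      obtain ⟨u, rfl⟩ := (vertexEquiv m n).surjective u
      obtain ⟨v, rfl⟩ := (vertexEquiv m n).surjective v
      rcases u with ⟨j, i⟩ | ⟨j, i⟩ <;> rcases v with ⟨l, k⟩ | ⟨l, k⟩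
      · rw [diamond_adj] at hadj
        simp [vertexEquiv] at hadj
        omega
      · exact h j i l k hadj ⟨(vertexEquiv_inl_mem_columnsEquiv a j i).1 hu,
          (vertexEquiv_inr_mem_columnsEquiv a l k).1 hv⟩
      · exact h l k j i hadj.symm ⟨(vertexEquiv_inl_mem_columnsEquiv a l k).1 hv,
          (vertexEquiv_inr_mem_columnsEquiv a j i).1 hu⟩
      · rw [diamond_adj] at hadj
        simp [vertexEquiv] at hadj
        omega
  rw [key]
  simp only [diamond_adj_inl_inr]
  constructor
  · exact fun h l => ⟨fun i k hk => h _ i l k ⟨hk, .inl rfl⟩, fun i k hk => h _ i l k ⟨hk, .inr rfl⟩⟩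
  · rintro h j i l k ⟨hk, rfl | rfl⟩
    exacts [(h l).1 i k hk, (h l).2 i k hk]

theorem numIndepSets_eq_card (m n : ℕ) :
    numIndepSets m n = Nat.card (OpenWalk (StepRel m) n) :=
  (Nat.card_congr ((columnsEquiv m n).subtypeEquiv fun a =>
    (isIndepSet_columnsEquiv_iff a).symm)).symm

theorem numIndepSets_eq_sum (m n : ℕ) :
    (numIndepSets m n : ℝ) = ∑ u, ∑ v, (transferMatrix m ^ n) u v := by
  rw [sum_transferMatrix_pow, numIndepSets_eq_card]

theorem numIndepSets_comm (m n : ℕ) : numIndepSets m n = numIndepSets n m := by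
  rw [numIndepSets_eq_card, numIndepSets_eq_card, Nat.card_congr (openWalkEquiv m n)]

end Counting

/-! ### Exact matrix-vector products on binary trees, and certified eigenvalue brackets. -/

section Evaluation

open Matrix

/-- The vectors of natural numbers indexed by `{0,1}^m`, as complete binary trees: the first
coordinate selects the subtree. -/
def Vec : ℕ → Type
  | 0 => ℕ
  | m + 1 => Vec m × Vec m

namespace Vec

/-- The entry of a vector at an index. -/
def get : {m : ℕ} → Vec m → (Fin m → Bool) → ℕ
  | 0, a, _ => a
  | _ + 1, x, v => bif v 0 then get x.2 (Fin.tail v) else get x.1 (Fin.tail v)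

/-- The constant vector. -/
def const (c : ℕ) : (m : ℕ) → Vec m
  | 0 => c
  | m + 1 => (const c m, const c m)

/-- The entrywise application of a function. -/
def zipWith (f : ℕ → ℕ → ℕ) : {m : ℕ} → Vec m → Vec m → Vec m
  | 0, a, b => f a b
  | _ + 1, a, b => (zipWith f a.1 b.1, zipWith f a.2 b.2)

/-- Whether all pairs of corresponding entries satisfy a test. -/
def all₂ (p : ℕ → ℕ → Bool) : {m : ℕ} → Vec m → Vec m → Bool
  | 0, a, b => p a b
  | _ + 1, a, b => all₂ p a.1 b.1 && all₂ p a.2 b.2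

/-- The product of the transpose of `stepMatrix m` with a vector. -/
def step : {m : ℕ} → Vec m → Vec (m + 1)
  | 0, a => (a, a)
  | _ + 1, x =>
    -- Let w be the output index. If w 0 is true, then v 0 must be false and only `x.1` contributes.
    -- If w 0 is false, both subtrees contribute when w 1 is false, and again only `x.1` when w 1 is
    -- true.
    let a := step x.1
    ((zipWith Nat.add a.1 (step x.2).1, a.2), a)

/-- The entries for which the last coordinate of the index is `b`. -/
def slice (b : Bool) : {m : ℕ} → Vec (m + 1) → Vec m
  | 0, x => bif b then x.2 else x.1
  | _ + 1, x => (slice b x.1, slice b x.2)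

/-- The vector whose entry is that of `x` or of `y` according to the last coordinate of the
index. -/
def mergeLast : {m : ℕ} → Vec (m + 1) → Vec (m + 1) → Vec (m + 1)
  | 0, x, y => (x.1, y.2)
  | _ + 1, x, y => (mergeLast x.1 y.1, mergeLast x.2 y.2)

/-- The product of `transferMatrix m` with a vector. -/
def transfer {m : ℕ} (x : Vec m) : Vec m := slice false (step (step x)).1

/-- The product of the transpose of `cylStepMatrix (m + 1)` with a vector. -/
def cylStep {m : ℕ} (x : Vec (m + 1)) : Vec (m + 1) :=
  (slice false (step x).1, slice true (step x).2)

/-- The product of `cylTransferMatrix (m + 1)` with a vector. -/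
def cylTransfer {m : ℕ} (x : Vec (m + 1)) : Vec (m + 1) :=
  mergeLast (step (cylStep x)).1 (step (cylStep x)).2

/-- An approximate dominant eigenvector of `T`, by a power iteration with shifts. -/
def shiftedPower {m : ℕ} (T : Vec m → Vec m) (shifts : List ℕ) : Vec m :=
  -- Truncated subtraction is harmless: positivity and the bracket are tested on the resulting
  -- vector itself.
  shifts.foldr (fun c x => zipWith (fun a b => Nat.sub a (Nat.mul c b)) (T x) x) (const 1 m)

/-- Whether `x` is positive and `lo * x ≤ d * T x ≤ hi * x` entrywise. -/
def isBracketed {m : ℕ} (T : Vec m → Vec m) (d lo hi : ℕ) (x : Vec m) : Bool :=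
  all₂ (fun a b => Nat.ble 1 b && Nat.ble (Nat.mul lo b) (Nat.mul d a) &&
    Nat.ble (Nat.mul d a) (Nat.mul hi b)) (T x) x

theorem get_succ {m : ℕ} (x : Vec (m + 1)) (v : Fin (m + 1) → Bool) :
    get x v = bif v 0 then get x.2 (Fin.tail v) else get x.1 (Fin.tail v) := rfl

theorem get_zipWith (f : ℕ → ℕ → ℕ) {m : ℕ} (x y : Vec m) (v : Fin m → Bool) :
    get (zipWith f x y) v = f (get x v) (get y v) := by
  induction m with
  | zero => rfl
  | succ m ih =>
    rw [get_succ, get_succ, get_succ]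
    cases v 0
    exacts [ih _ _ _, ih _ _ _]

theorem all₂_iff (p : ℕ → ℕ → Bool) {m : ℕ} (x y : Vec m) :
    all₂ p x y = true ↔ ∀ v, p (get x v) (get y v) = true := by
  induction m with
  | zero => exact ⟨fun h _ => h, fun h => h Fin.elim0⟩
  | succ m ih =>
    simp only [all₂, Bool.and_eq_true, ih]
    constructor
    · rintro ⟨h1, h2⟩ v
      simp only [get_succ]
      cases v 0
      exacts [h1 _, h2 _]
    · intro h
      exact ⟨fun v => by simpa [get_succ] using h (Fin.cons false v),
        fun v => by simpa [get_succ] using h (Fin.cons true v)⟩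

theorem get_slice (b : Bool) {m : ℕ} (x : Vec (m + 1)) (v : Fin m → Bool) :
    get (slice b x) v = get x (Fin.snoc v b) := by
  induction m with
  | zero => cases b <;> rfl
  | succ m ih =>
    have h : (Fin.tail (Fin.snoc v b : Fin (m + 2) → Bool)) = Fin.snoc (Fin.tail v) b := by
      conv_lhs => rw [← Fin.cons_self_tail v, ← Fin.cons_snoc_eq_snoc_cons, Fin.tail_cons]
    have h0 : (Fin.snoc v b : Fin (m + 2) → Bool) 0 = v 0 := Fin.snoc_castSucc (i := 0) ..
    rw [get_succ, get_succ (m := m + 1), h, h0]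
    cases v 0
    exacts [ih _ _, ih _ _]

theorem get_mergeLast {m : ℕ} (x y : Vec (m + 1)) (v : Fin (m + 1) → Bool) :
    get (mergeLast x y) v = bif v (Fin.last m) then get y v else get x v := by
  induction m with
  | zero =>
    rw [show Fin.last 0 = 0 from rfl, get_succ, get_succ, get_succ]
    cases v 0 <;> rfl
  | succ m ih =>
    rw [get_succ, get_succ (m := m + 1), get_succ (m := m + 1)]
    have h : Fin.tail v (Fin.last m) = v (Fin.last (m + 1)) := rfl
    cases v 0 <;> simp only [mergeLast, ih, h, cond_true, cond_false]

theorem stepRel_succ_iff {m : ℕ} (v : Fin (m + 1) → Bool) (w : Fin (m + 2) → Bool) :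
    StepRel (m + 1) v w ↔ ¬(v 0 = true ∧ w 0 = true) ∧ ¬(v 0 = true ∧ Fin.tail w 0 = true) ∧
      StepRel m (Fin.tail v) (Fin.tail w) := by
  rw [stepRel_iff, stepRel_iff, Fin.forall_fin_succ, and_assoc]
  rfl

theorem sum_cons {m : ℕ} (g : (Fin (m + 1) → Bool) → ℕ) :
    ∑ v, g v = (∑ v, g (Fin.cons true v)) + ∑ v, g (Fin.cons false v) := by
  rw [← (Fin.consEquiv fun _ => Bool).sum_comp, Fintype.sum_prod_type, Fintype.sum_bool]
  rfl

theorem get_step {m : ℕ} (x : Vec m) (w : Fin (m + 1) → Bool) :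
    get (step x) w = ∑ v, if StepRel m v w then get x v else 0 := by
  induction m with
  | zero =>
    rw [Fintype.sum_unique, if_pos fun i => i.elim0, get_succ]
    cases w 0 <;> rfl
  | succ m ih =>
    rw [sum_cons]
    simp only [stepRel_succ_iff, Fin.cons_zero, Fin.tail_cons, get_succ x, cond_true, cond_false]
    have hstep : step x = ((zipWith Nat.add (step x.1).1 (step x.2).1, (step x.1).2), step x.1) :=
      rfl
    rw [get_succ, hstep]
    cases h0 : w 0
    · rw [cond_false, get_succ]
      cases h1 : Fin.tail w 0
      · have e : ∀ y : Vec m, get (step y) (Fin.tail w) = get (step y).1 (Fin.tail (Fin.tail w)) :=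
          fun y => by rw [get_succ, h1, cond_false]
        simp [get_zipWith, ← ih, e, add_comm]
      · have e : ∀ y : Vec m, get (step y) (Fin.tail w) = get (step y).2 (Fin.tail (Fin.tail w)) :=
          fun y => by rw [get_succ, h1, cond_true]
        simp [← ih, e]
    · simp [← ih]

/-- Empty cells added at both ends impose nothing, and the padded narrow column becomes the wide
one. Thus `step` also computes products with the untransposed matrix. -/
theorem stepRel_cons_snoc_iff {m : ℕ} (v : Fin m → Bool) (w : Fin (m + 1) → Bool) :
    StepRel (m + 1) w (Fin.cons false (Fin.snoc v false : Fin (m + 1) → Bool)) ↔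
      StepRel m v w := by
  rw [stepRel_iff, stepRel_iff, forall_and, forall_and]
  have h1 : ∀ i : Fin (m + 1),
      (Fin.cons false (Fin.snoc v false : Fin (m + 1) → Bool) : Fin (m + 2) → Bool) i.castSucc =
        (Fin.cons false v : Fin (m + 1) → Bool) i := fun i => by
    rw [Fin.cons_snoc_eq_snoc_cons, Fin.snoc_castSucc]
  simp only [h1, Fin.cons_succ]
  rw [Fin.forall_fin_succ, Fin.forall_fin_succ' (n := m)]
  simp [and_comm]

theorem get_slice_step {m : ℕ} (y : Vec (m + 1)) (v : Fin m → Bool) :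
    get (slice false (step y).1) v = ∑ w, if StepRel m v w then get y w else 0 := by
  have h : get (slice false (step y).1) v =
      get (step y) (Fin.cons false (Fin.snoc v false : Fin (m + 1) → Bool)) := by
    rw [get_slice, get_succ (step y)]; simp
  rw [h, get_step]
  exact Finset.sum_congr rfl fun w _ => if_congr (stepRel_cons_snoc_iff v w) rfl rfl

/-- The cycle is cut open: a cyclic row is a linear one with its first entry repeated at the end. -/
theorem get_cylStep {m : ℕ} (x : Vec (m + 1)) (w : Fin (m + 1) → Bool) :
    get (cylStep x) w = ∑ v, if CylStepRel (m + 1) v w then get x v else 0 := by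
  have h0 : (Fin.snoc w (w 0) : Fin (m + 2) → Bool) 0 = w 0 := Fin.snoc_castSucc (i := 0) ..
  have h : get (cylStep x) w = get (step x) (Fin.snoc w (w 0) : Fin (m + 2) → Bool) := by
    have ht : (Fin.tail (Fin.snoc w (w 0) : Fin (m + 2) → Bool)) =
        Fin.snoc (Fin.tail w) (w 0) := by
      conv_lhs => rw [← Fin.cons_self_tail w, ← Fin.cons_snoc_eq_snoc_cons, Fin.tail_cons]
      rfl
    rw [get_succ, get_succ (step x), ht, h0]
    cases h1 : w 0
    exacts [get_slice _ _ _, get_slice _ _ _]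
  rw [h, get_step]
  refine Finset.sum_congr rfl fun v _ => if_congr ?_ rfl rfl
  have hs : ∀ i : Fin (m + 1), (Fin.snoc w (w 0) : Fin (m + 2) → Bool) i.succ = w (i + 1) := by
    refine Fin.lastCases ?_ fun i => ?_
    · rw [Fin.succ_last, Fin.snoc_last, Fin.last_add_one]
    · rw [Fin.succ_castSucc, Fin.snoc_castSucc, Fin.coeSucc_eq_succ]
  rw [stepRel_iff, cylStepRel_iff]
  simp only [hs, Fin.snoc_castSucc]

/-- For the untransposed matrix the cyclic neighbours of `w i` are `v (i - 1)` and `v i`, so the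
last entry is repeated in front instead. -/
theorem get_mergeLast_step {m : ℕ} (y : Vec (m + 1)) (v : Fin (m + 1) → Bool) :
    get (mergeLast (step y).1 (step y).2) v =
      ∑ w, if CylStepRel (m + 1) v w then get y w else 0 := by
  have h : get (mergeLast (step y).1 (step y).2) v =
      get (step y) (Fin.cons (v (Fin.last m)) v : Fin (m + 2) → Bool) := by
    rw [get_mergeLast, get_succ (step y), Fin.cons_zero, Fin.tail_cons]
  rw [h, get_step]
  refine Finset.sum_congr rfl fun w _ => if_congr ?_ rfl rfl
  have hs : ∀ i : Fin (m + 1),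
      (Fin.cons (v (Fin.last m)) v : Fin (m + 2) → Bool) (i + 1).castSucc = v i := by
    refine Fin.lastCases ?_ fun i => ?_
    · rw [Fin.last_add_one, Fin.castSucc_zero, Fin.cons_zero]
    · rw [Fin.coeSucc_eq_succ, ← Fin.succ_castSucc, Fin.cons_succ]
  -- Shifting the index cyclically by one turns the conflicts of `w i` with `v (i - 1)` into those
  -- of `w (i + 1)` with `v i`.
  rw [stepRel_iff, cylStepRel_iff, forall_and, forall_and, and_comm,
    ← (Equiv.addRight (1 : Fin (m + 1))).forall_congr_right
      (q := fun i => ¬(w i = true ∧ (Fin.cons (v (Fin.last m)) v : Fin (m + 2) → Bool)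
        i.castSucc = true))]
  simp only [Equiv.coe_addRight, hs, Fin.cons_succ, and_comm]

theorem stepMatrix_apply (m : ℕ) (v : Fin m → Bool) (w : Fin (m + 1) → Bool) :
    stepMatrix m v w = if StepRel m v w then 1 else 0 := rfl

theorem cylStepMatrix_apply (n : ℕ) (v w : Fin n → Bool) :
    cylStepMatrix n v w = if CylStepRel n v w then 1 else 0 := rfl

theorem transferMatrix_mulVec {m : ℕ} (x : Vec m) :
    transferMatrix m *ᵥ (fun v => (get x v : ℝ)) = fun v => (get (transfer x) v : ℝ) := by
  have h1 : (stepMatrix m)ᵀ *ᵥ (fun v => (get x v : ℝ)) = fun w => (get (step x) w : ℝ) := by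
    ext w
    simp [get_step, Matrix.mulVec, dotProduct, stepMatrix_apply]
  rw [transferMatrix, ← Matrix.mulVec_mulVec, h1]
  ext v
  simp [transfer, get_slice_step, Matrix.mulVec, dotProduct, stepMatrix_apply]

theorem cylTransferMatrix_mulVec {m : ℕ} (x : Vec (m + 1)) :
    cylTransferMatrix (m + 1) *ᵥ (fun v => (get x v : ℝ)) =
      fun v => (get (cylTransfer x) v : ℝ) := by
  have h1 : (cylStepMatrix (m + 1))ᵀ *ᵥ (fun v => (get x v : ℝ)) =
      fun w => (get (cylStep x) w : ℝ) := by
    ext w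
    simp [get_cylStep, Matrix.mulVec, dotProduct, cylStepMatrix_apply]
  rw [cylTransferMatrix, ← Matrix.mulVec_mulVec, h1]
  ext v
  simp [cylTransfer, get_mergeLast_step, Matrix.mulVec, dotProduct, cylStepMatrix_apply]

end Vec

theorem transferMatrix_nonneg (m : ℕ) (u v : Fin m → Bool) : 0 ≤ transferMatrix m u v := by
  refine Finset.sum_nonneg fun w _ => mul_nonneg ?_ ?_ <;>
    simp only [stepMatrix, Matrix.of_apply, Matrix.transpose_apply] <;> split_ifs <;> norm_num

theorem cylTransferMatrix_nonneg (n : ℕ) (u v : Fin n → Bool) : 0 ≤ cylTransferMatrix n u v := by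
  refine Finset.sum_nonneg fun w _ => mul_nonneg ?_ ?_ <;>
    simp only [cylStepMatrix, Matrix.of_apply, Matrix.transpose_apply] <;> split_ifs <;> norm_num

theorem transferMatrix_posSemidef (m : ℕ) : (transferMatrix m).PosSemidef :=
  posSemidef_mul_transpose _

theorem cylTransferMatrix_posSemidef (n : ℕ) : (cylTransferMatrix n).PosSemidef :=
  posSemidef_mul_transpose _

/-- These are the two Collatz–Wielandt bounds with the common denominator `d` cleared, so that the
test involves natural numbers only. -/
theorem largestEigenvalue_mem_Icc_of_isBracketed {m : ℕ}
    {A : Matrix (Fin m → Bool) (Fin m → Bool) ℝ} (hA : A.PosSemidef) (hs : A.IsSymm)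
    (h0 : ∀ u v, 0 ≤ A u v) {T : Vec m → Vec m} {x : Vec m}
    (hT : A *ᵥ (fun v => (x.get v : ℝ)) = fun v => ((T x).get v : ℝ)) {d lo hi : ℕ} (hd : 0 < d)
    (h : Vec.isBracketed T d lo hi x = true) :
    largestEigenvalue A ∈ Set.Icc ((lo : ℝ) / d) (hi / d) := by
  rw [Vec.isBracketed, Vec.all₂_iff] at h
  simp only [Bool.and_eq_true, Nat.ble_eq, Nat.mul_eq] at h
  have hd' : (0 : ℝ) < d := by exact_mod_cast hd
  have hx : ∀ v, (0 : ℝ) < x.get v := fun v => by exact_mod_cast (h v).1.1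
  constructor
  · refine le_largestEigenvalue_of_le_mulVec hA hx fun v => ?_
    rw [hT, div_mul_eq_mul_div, div_le_iff₀ hd', mul_comm _ (d : ℝ)]
    dsimp only
    exact_mod_cast (h v).1.2
  · refine largestEigenvalue_le_of_mulVec_le hs h0 hx fun v => ?_
    rw [hT, div_mul_eq_mul_div, le_div_iff₀ hd', mul_comm _ (d : ℝ)]
    dsimp only
    exact_mod_cast (h v).2

theorem lam_mem_Icc_of_isBracketed {m d lo hi : ℕ} (hd : 0 < d) {x : Vec m}
    (h : Vec.isBracketed Vec.transfer d lo hi x = true) :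
    lam m ∈ Set.Icc ((lo : ℝ) / d) (hi / d) :=
  largestEigenvalue_mem_Icc_of_isBracketed (transferMatrix_posSemidef m) (transferMatrix_isSymm m)
    (transferMatrix_nonneg m) (Vec.transferMatrix_mulVec x) hd h

theorem xi_mem_Icc_of_isBracketed {m d lo hi : ℕ} (hd : 0 < d) {x : Vec (m + 1)}
    (h : Vec.isBracketed Vec.cylTransfer d lo hi x = true) :
    xi (m + 1) ∈ Set.Icc ((lo : ℝ) / d) (hi / d) :=
  largestEigenvalue_mem_Icc_of_isBracketed (cylTransferMatrix_posSemidef _)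
    (cylTransferMatrix_isSymm _) (cylTransferMatrix_nonneg _) (Vec.cylTransferMatrix_mulVec x) hd h

end Evaluation

/-! ### Brackets for the three largest eigenvalues. -/

section NumericalBounds

/-- The shifts are rounded Chebyshev nodes of [0, 2180], and of [0, 420] and [0, 1225] in the next
two lemmas. The product of the factors T - c is then small on that interval relative to its value at
the dominant eigenvalue. -/
theorem lam_ten_mem_Icc : lam 10 ∈ Set.Icc (6402.6838422679 : ℝ) 6402.6838422743 := by
  have h : Vec.isBracketed Vec.transfer (10 ^ 10) 64026838422679 64026838422743
      (Vec.shiftedPower (m := 10) Vec.transfer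
        [2172, 2109, 1987, 1813, 1597, 1351, 1090, 829, 583, 367, 193, 71, 8]) = true := by
    decide +kernel
  have := lam_mem_Icc_of_isBracketed (by norm_num) h
  norm_num at this ⊢
  exact this

theorem lam_eight_mem_Icc : lam 8 ∈ Set.Icc (1254.5229776171 : ℝ) 1254.5229776176 := by
  have h : Vec.isBracketed Vec.transfer (10 ^ 10) 12545229776171 12545229776176
      (Vec.shiftedPower (m := 8) Vec.transfer
        [418, 406, 383, 349, 308, 260, 210, 160, 112, 71, 37, 14, 2]) = true := by
    decide +kernel
  have := lam_mem_Icc_of_isBracketed (by norm_num) h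
  norm_num at this ⊢
  exact this

theorem xi_ten_mem_Icc : xi 10 ∈ Set.Icc (3463.0530655 : ℝ) 3463.0530709 := by
  have h : Vec.isBracketed (Vec.cylTransfer (m := 9)) (10 ^ 7) 34630530655 34630530709
      (Vec.shiftedPower (Vec.cylTransfer (m := 9))
        [1217, 1158, 1046, 891, 708, 517, 334, 179, 67, 8]) = true := by
    decide +kernel
  have := xi_mem_Icc_of_isBracketed (by norm_num) h
  norm_num at this ⊢
  exact this

end NumericalBounds

/-! ### The limits and their bounds by eigenvalues. -/

section Entropy

open Filter Matrix

theorem one_dotProduct_pow_mulVec_one (m n : ℕ) :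
    (fun _ => (1 : ℝ)) ⬝ᵥ (transferMatrix m ^ n *ᵥ fun _ => 1) = numIndepSets m n := by
  rw [numIndepSets_eq_sum]
  simp [dotProduct, mulVec]

theorem lam_nonneg (m : ℕ) : 0 ≤ lam m := largestEigenvalue_nonneg (transferMatrix_posSemidef m)

theorem xi_nonneg (n : ℕ) : 0 ≤ xi n := largestEigenvalue_nonneg (cylTransferMatrix_posSemidef n)

theorem pow_transferMatrix_nonneg (m n : ℕ) (u v : Fin m → Bool) :
    0 ≤ (transferMatrix m ^ n) u v := by
  induction n generalizing u v with
  | zero => rw [pow_zero, Matrix.one_apply]; split_ifs <;> norm_num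
  | succ n ih =>
    rw [pow_succ, Matrix.mul_apply]
    exact Finset.sum_nonneg fun w _ => mul_nonneg (ih _ _) (transferMatrix_nonneg _ _ _)

/-- The trace is a part of the sum of all entries, which are nonnegative. -/
theorem lam_pow_le_numIndepSets (m n : ℕ) : lam m ^ n ≤ numIndepSets m n := by
  refine (largestEigenvalue_pow_le_trace (transferMatrix_posSemidef m) n).trans ?_
  rw [numIndepSets_eq_sum]
  exact Finset.sum_le_sum fun u _ => Finset.single_le_sum
    (f := fun v => (transferMatrix m ^ n) u v)
    (fun v _ => pow_transferMatrix_nonneg m n u v) (Finset.mem_univ u)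

theorem numIndepSets_le (m n : ℕ) : (numIndepSets m n : ℝ) ≤ lam m ^ n * 2 ^ m := by
  have h := dotProduct_pow_mulVec_le (transferMatrix_posSemidef m) n fun _ => (1 : ℝ)
  rw [one_dotProduct_pow_mulVec_one] at h
  simpa [dotProduct, lam] using h

/-- This is the Rayleigh bound for T^p at the vector T^q·1. By symmetry one factor T^q moves across
the scalar product, whence the even number 2q. -/
theorem numIndepSets_add_le (m p q : ℕ) :
    (numIndepSets m (p + 2 * q) : ℝ) ≤ lam m ^ p * numIndepSets m (2 * q) := by
  set T := transferMatrix m with hT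
  have hsq : (T ^ q)ᵀ = T ^ q := by
    rw [transpose_pow, (transferMatrix_isSymm m).eq]
  have key : ∀ z : (Fin m → Bool) → ℝ,
      (T ^ q *ᵥ fun _ => (1 : ℝ)) ⬝ᵥ z = (fun _ => (1 : ℝ)) ⬝ᵥ (T ^ q *ᵥ z) := fun z => by
    rw [dotProduct_mulVec, ← mulVec_transpose, hsq]
  have h := dotProduct_pow_mulVec_le (transferMatrix_posSemidef m) p (T ^ q *ᵥ fun _ => (1 : ℝ))
  rw [key, key, ← hT, mulVec_mulVec, mulVec_mulVec, mulVec_mulVec, ← pow_add, ← pow_add,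
    ← pow_add, one_dotProduct_pow_mulVec_one, one_dotProduct_pow_mulVec_one] at h
  rwa [show p + 2 * q = q + p + q by ring, two_mul]

theorem one_le_numIndepSets (m n : ℕ) : (1 : ℝ) ≤ numIndepSets m n := by
  have : Nonempty (OpenWalk (StepRel m) n) :=
    ⟨⟨(fun _ _ => false, fun _ _ => false), fun _ => ⟨fun _ _ _ h => by simp at h, fun _ _ _ h => by simp at h⟩⟩⟩
  rw [numIndepSets_eq_card]
  exact_mod_cast Nat.card_pos

theorem lam_pos (m : ℕ) : 0 < lam m := by
  refine (lam_nonneg m).lt_of_ne fun h => ?_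
  have h1 := (one_le_numIndepSets m 1).trans (numIndepSets_le m 1)
  rw [← h] at h1
  norm_num at h1

theorem lam_pow_le_xi (m k : ℕ) : lam m ^ (k + 1) ≤ xi (k + 1) ^ m * 2 ^ (k + 1) := by
  refine (largestEigenvalue_pow_le_trace (transferMatrix_posSemidef m) (k + 1)).trans ?_
  rw [trace_transferMatrix_pow]
  have h := dotProduct_pow_mulVec_le (cylTransferMatrix_posSemidef (k + 1)) m fun _ => (1 : ℝ)
  simpa [dotProduct, mulVec, xi] using h

theorem xi_pos (k : ℕ) : 0 < xi (k + 1) := by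
  refine (xi_nonneg _).lt_of_ne fun h => ?_
  have h1 := lam_pow_le_xi 1 k
  rw [← h] at h1
  have := pow_pos (lam_pos 1) (k + 1)
  norm_num at h1
  linarith

/-- The logarithm of the largest eigenvalue of the transfer matrix, per unit of width. -/
noncomputable def logRate (m : ℕ) : ℝ := Real.log (lam m) / m

/-- The logarithm of the number of independent sets per cell. -/
noncomputable def logDensity (m n : ℕ) : ℝ := Real.log (numIndepSets m n) / (m * n)

theorem logDensity_comm (m n : ℕ) : logDensity m n = logDensity n m := by
  rw [logDensity, logDensity, numIndepSets_comm, mul_comm]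

theorem logRate_le_logDensity {m n : ℕ} (hm : 1 ≤ m) (hn : 1 ≤ n) :
    logRate m ≤ logDensity m n := by
  have hm' : (0 : ℝ) < m := by exact_mod_cast hm
  have hn' : (0 : ℝ) < n := by exact_mod_cast hn
  have h := Real.log_le_log (pow_pos (lam_pos m) n) (lam_pow_le_numIndepSets m n)
  rw [Real.log_pow] at h
  rw [logRate, logDensity, div_le_div_iff₀ hm' (by positivity)]
  nlinarith

theorem logDensity_le {m n : ℕ} (hm : 1 ≤ m) (hn : 1 ≤ n) :
    logDensity m n ≤ logRate m + Real.log 2 / n := by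
  have hm' : (0 : ℝ) < m := by exact_mod_cast hm
  have hn' : (0 : ℝ) < n := by exact_mod_cast hn
  have h := Real.log_le_log (by linarith [one_le_numIndepSets m n]) (numIndepSets_le m n)
  rw [Real.log_mul (pow_pos (lam_pos m) n).ne' (by positivity), Real.log_pow, Real.log_pow] at h
  rw [logRate, logDensity, div_add_div _ _ hm'.ne' hn'.ne']
  gcongr
  linarith

/-- Two rates are compared through the density of a single diamond, which is symmetric in its two
orders: one rate bounds it from below, the other from above up to log 2 over the other order. -/
theorem cauchySeq_logRate : CauchySeq logRate := by
  -- The shift discards the index 0, where the rate is a division by zero.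
  rw [← cauchySeq_shift 1]
  refine cauchySeq_of_le_tendsto_0 (fun N : ℕ => Real.log 2 / ((N + 1 : ℕ) : ℝ)) ?_
    ((tendsto_const_div_atTop_nhds_zero_nat (Real.log 2)).comp (tendsto_add_atTop_nat 1))
  have h : ∀ {n m N : ℕ}, N ≤ n → N ≤ m →
      logRate (n + 1) ≤ logRate (m + 1) + Real.log 2 / ((N + 1 : ℕ) : ℝ) := by
    intro n m N hn hm
    calc logRate (n + 1) ≤ logDensity (n + 1) (m + 1) :=
          logRate_le_logDensity (by omega) (by omega)
      _ = logDensity (m + 1) (n + 1) := logDensity_comm _ _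
      _ ≤ logRate (m + 1) + Real.log 2 / ((n + 1 : ℕ) : ℝ) :=
          logDensity_le (by omega) (by omega)
      _ ≤ _ := by gcongr
  intro n m N hn hm
  rw [Real.dist_eq, abs_sub_le_iff]
  exact ⟨by linarith [h hn hm], by linarith [h hm hn]⟩

theorem tendsto_logDensity {l : ℝ} (hl : Tendsto logRate atTop (nhds l)) :
    Tendsto (fun a : ℕ × ℕ => logDensity a.1 a.2) (atTop ×ˢ atTop) (nhds l) := by
  have h1 : Tendsto (fun a : ℕ × ℕ => logRate a.1) (atTop ×ˢ atTop) (nhds l) :=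
    hl.comp tendsto_fst
  have h2 : Tendsto (fun a : ℕ × ℕ => logRate a.1 + Real.log 2 / a.2) (atTop ×ˢ atTop)
      (nhds l) := by
    simpa using h1.add ((tendsto_const_div_atTop_nhds_zero_nat (Real.log 2)).comp tendsto_snd)
  have h3 : ∀ᶠ a : ℕ × ℕ in atTop ×ˢ atTop, 1 ≤ a.1 ∧ 1 ≤ a.2 :=
    (eventually_ge_atTop 1).prod_mk (eventually_ge_atTop 1)
  refine tendsto_of_tendsto_of_tendsto_of_le_of_le' h1 h2 ?_ ?_
  · filter_upwards [h3] with a ha using logRate_le_logDensity ha.1 ha.2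
  · filter_upwards [h3] with a ha using logDensity_le ha.1 ha.2

theorem tendsto_numIndepSets_rpow {l : ℝ} (hl : Tendsto logRate atTop (nhds l)) :
    Tendsto (fun a : ℕ × ℕ => (numIndepSets a.1 a.2 : ℝ) ^ ((1 : ℝ) / ((a.1 : ℝ) * (a.2 : ℝ))))
      (atTop ×ˢ atTop) (nhds (Real.exp l)) := by
  refine ((Real.continuous_exp.tendsto l).comp (tendsto_logDensity hl)).congr fun a => ?_
  rw [Real.rpow_def_of_pos (by linarith [one_le_numIndepSets a.1 a.2])]
  simp only [Function.comp, logDensity, mul_one_div]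

theorem tendsto_mul_div_numVertices :
    Tendsto (fun a : ℕ × ℕ => (a.1 : ℝ) * a.2 / numVertices a.1 a.2) (atTop ×ˢ atTop)
      (nhds (1 / 2)) := by
  have h1 : Tendsto (fun a : ℕ × ℕ => (1 : ℝ) / (2 + 1 / a.2 + 1 / a.1)) (atTop ×ˢ atTop)
      (nhds (1 / 2)) := by
    have h2 := ((tendsto_const_nhds (x := (2 : ℝ)) (f := atTop ×ˢ atTop)).add
      ((tendsto_const_div_atTop_nhds_zero_nat (1 : ℝ)).comp
        (tendsto_snd (f := (atTop : Filter ℕ))))).add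
      ((tendsto_const_div_atTop_nhds_zero_nat (1 : ℝ)).comp
        (tendsto_fst (g := (atTop : Filter ℕ))))
    rw [add_zero, add_zero] at h2
    exact (tendsto_const_nhds (x := (1 : ℝ))).div h2 two_ne_zero
  refine h1.congr' ?_
  filter_upwards [(eventually_ge_atTop 1).prod_mk (eventually_ge_atTop 1)] with a ha
  have h1' : (0 : ℝ) < a.1 := by exact_mod_cast ha.1
  have h2' : (0 : ℝ) < a.2 := by exact_mod_cast ha.2
  rw [numVertices_eq]
  push_cast
  field_simp

theorem tendsto_numIndepSets_rpow_numVertices {l : ℝ} (hl : Tendsto logRate atTop (nhds l)) :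
    Tendsto (fun a : ℕ × ℕ =>
      (numIndepSets a.1 a.2 : ℝ) ^ ((1 : ℝ) / (numVertices a.1 a.2 : ℝ)))
      (atTop ×ˢ atTop) (nhds (Real.exp (l / 2))) := by
  have h := (tendsto_logDensity hl).mul tendsto_mul_div_numVertices
  rw [mul_one_div] at h
  refine ((Real.continuous_exp.tendsto _).comp h).congr' ?_
  filter_upwards [(eventually_ge_atTop 1).prod_mk (eventually_ge_atTop 1)] with a ha
  have h1' : (0 : ℝ) < a.1 := by exact_mod_cast ha.1
  have h2' : (0 : ℝ) < a.2 := by exact_mod_cast ha.2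
  rw [Real.rpow_def_of_pos (by linarith [one_le_numIndepSets a.1 a.2])]
  simp only [Function.comp, logDensity]
  congr 1
  field_simp

theorem tendsto_const_add_nat_mul_div (c x : ℝ) :
    Tendsto (fun n : ℕ => (c + n * x) / n) atTop (nhds x) := by
  have h : Tendsto (fun n : ℕ => c / n + x) atTop (nhds (0 + x)) :=
    (tendsto_const_div_atTop_nhds_zero_nat c).add_const x
  rw [zero_add] at h
  refine h.congr' ?_
  filter_upwards [eventually_ge_atTop 1] with n hn
  have : (0 : ℝ) < n := by exact_mod_cast hn
  field_simp

theorem lam_div_rpow_le {l : ℝ} (hl : Tendsto logRate atTop (nhds l)) {p : ℕ} (q : ℕ)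
    (hp : 1 ≤ p) : (lam (p + 2 * q) / lam (2 * q)) ^ ((1 : ℝ) / (p : ℝ)) ≤ Real.exp l := by
  have hp' : (0 : ℝ) < p := by exact_mod_cast hp
  set x := Real.log (lam (p + 2 * q)) with hx
  set y := Real.log (lam (2 * q)) with hy
  have h1 : ∀ n : ℕ, 1 ≤ n → x ≤ p * logRate n + (2 * q * Real.log 2 + n * y) / n := by
    intro n hn
    have hn' : (0 : ℝ) < n := by exact_mod_cast hn
    -- The factor `2 ^ (2 * q)` does not depend on `n`, so it disappears from the n-th root.
    have h2 : lam (p + 2 * q) ^ n ≤ lam n ^ p * (lam (2 * q) ^ n * 2 ^ (2 * q)) := by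
      calc lam (p + 2 * q) ^ n ≤ numIndepSets (p + 2 * q) n := lam_pow_le_numIndepSets _ _
        _ = numIndepSets n (p + 2 * q) := by rw [numIndepSets_comm]
        _ ≤ lam n ^ p * numIndepSets n (2 * q) := numIndepSets_add_le _ _ _
        _ = lam n ^ p * numIndepSets (2 * q) n := by rw [numIndepSets_comm]
        _ ≤ _ := mul_le_mul_of_nonneg_left (numIndepSets_le _ _) (pow_nonneg (lam_nonneg n) p)
    have h3 := Real.log_le_log (pow_pos (lam_pos _) n) h2
    rw [Real.log_mul (pow_pos (lam_pos _) _).ne'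
        (mul_pos (pow_pos (lam_pos _) _) (by positivity)).ne',
      Real.log_mul (pow_pos (lam_pos _) _).ne' (by positivity), Real.log_pow, Real.log_pow,
      Real.log_pow, Real.log_pow, ← hx, ← hy] at h3
    rw [logRate, ← mul_div_assoc, ← add_div, le_div_iff₀ hn']
    push_cast at h3
    linarith
  have h4 : x ≤ p * l + y :=
    ge_of_tendsto ((hl.const_mul (p : ℝ)).add (tendsto_const_add_nat_mul_div _ y))
      ((eventually_ge_atTop 1).mono h1)
  rw [Real.rpow_def_of_pos (div_pos (lam_pos _) (lam_pos _)), Real.exp_le_exp,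
    Real.log_div (lam_pos _).ne' (lam_pos _).ne', mul_one_div, div_le_iff₀ hp']
  linarith

/-- Odd circumferences are allowed too, since the trace bound for a positive semidefinite matrix
holds for every exponent. -/
theorem exp_le_xi_rpow {l : ℝ} (hl : Tendsto logRate atTop (nhds l)) {k : ℕ} (hk : 1 ≤ k) :
    Real.exp l ≤ xi k ^ ((1 : ℝ) / (k : ℝ)) := by
  obtain ⟨k, rfl⟩ := Nat.exists_eq_add_of_le' hk
  have hk' : (0 : ℝ) < (k + 1 : ℕ) := by exact_mod_cast hk
  have h1 : ∀ n : ℕ, 1 ≤ n → ((k + 1 : ℕ) : ℝ) * logRate n ≤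
      ((k + 1 : ℕ) * Real.log 2 + n * Real.log (xi (k + 1))) / n := by
    intro n hn
    have hn' : (0 : ℝ) < n := by exact_mod_cast hn
    have h3 := Real.log_le_log (pow_pos (lam_pos _) _) (lam_pow_le_xi n k)
    rw [Real.log_mul (pow_pos (xi_pos _) _).ne' (by positivity), Real.log_pow, Real.log_pow,
      Real.log_pow] at h3
    rw [logRate, ← mul_div_assoc, div_le_div_iff_of_pos_right hn']
    linarith
  have h4 := le_of_tendsto_of_tendsto (hl.const_mul _) (tendsto_const_add_nat_mul_div _ _)
    ((eventually_ge_atTop 1).mono h1)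
  rw [Real.rpow_def_of_pos (xi_pos _), Real.exp_le_exp, mul_one_div, le_div_iff₀ hk']
  linarith

end Entropy

/-! ### Decimal values of the outer bounds. -/

section NumericalBounds

/-- The lower end carries a tenth decimal because 1.503041110² = 2.25913257835… exceeds 2.259132578,
so nine decimals would not give the bound on the square root. -/
theorem lam_ratio_rpow_mem_Ico :
    (lam 10 / lam 8) ^ ((1 : ℝ) / 2) ∈ Set.Ico (2.2591325789 : ℝ) 2.259132579 := by
  obtain ⟨h1, h2⟩ := lam_ten_mem_Icc
  obtain ⟨h3, h4⟩ := lam_eight_mem_Icc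
  rw [← Real.sqrt_eq_rpow]
  constructor
  · refine Real.le_sqrt_of_sq_le ?_
    rw [le_div_iff₀ (by linarith)]
    nlinarith
  · rw [Real.sqrt_lt' (by norm_num), div_lt_iff₀ (by linarith)]
    nlinarith

theorem xi_rpow_mem_Ico :
    xi 10 ^ ((1 : ℝ) / 10) ∈ Set.Ico (2.259154406 : ℝ) 2.259154407 := by
  obtain ⟨h1, h2⟩ := xi_ten_mem_Icc
  have h : ∀ y : ℝ, 0 ≤ y → y = (y ^ 10) ^ ((1 : ℝ) / 10) := fun y hy => by
    rw [← Real.rpow_natCast, ← Real.rpow_mul hy]; norm_num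
  constructor
  · rw [h 2.259154406 (by norm_num)]
    exact Real.rpow_le_rpow (by norm_num) (le_trans (by norm_num) h1) (by norm_num)
  · rw [h 2.259154407 (by norm_num)]
    exact Real.rpow_lt_rpow (by linarith) (h2.trans_lt (by norm_num)) (by norm_num)

end NumericalBounds

end AztecDiamond

theorem mainTheorem4 :
    -- the transfer matrix is symmetric and it alone counts the independent sets
    (∀ m : ℕ, (AztecDiamond.transferMatrix m).IsSymm) ∧
    (∀ m n : ℕ, (AztecDiamond.numIndepSets m n : ℝ) =
      ∑ u : Fin m → Bool, ∑ v : Fin m → Bool, (AztecDiamond.transferMatrix m ^ n) u v) ∧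
    (∀ m n : ℕ, AztecDiamond.numVertices m n = 2 * m * n + m + n) ∧
    -- the two double limits, as `m` and `n` tend to infinity independently
    ∃ L η : ℝ,
      Filter.Tendsto
        (fun a : ℕ × ℕ =>
          (AztecDiamond.numIndepSets a.1 a.2 : ℝ) ^ ((1 : ℝ) / ((a.1 : ℝ) * (a.2 : ℝ))))
        (Filter.atTop ×ˢ Filter.atTop) (nhds L) ∧
      Filter.Tendsto
        (fun a : ℕ × ℕ =>
          (AztecDiamond.numIndepSets a.1 a.2 : ℝ) ^
            ((1 : ℝ) / (AztecDiamond.numVertices a.1 a.2 : ℝ)))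
        (Filter.atTop ×ˢ Filter.atTop) (nhds η) ∧
      η = Real.sqrt L ∧
      -- the bounds by the largest eigenvalues of transfer matrices
      (∀ p q : ℕ, 1 ≤ p →
        (AztecDiamond.lam (p + 2 * q) / AztecDiamond.lam (2 * q)) ^ ((1 : ℝ) / (p : ℝ)) ≤ L) ∧
      (∀ k : ℕ, 1 ≤ k →
        L ≤ AztecDiamond.xi (2 * k) ^ ((1 : ℝ) / ((2 * k : ℕ) : ℝ))) ∧
      -- their values for `p = 2`, `q = 4`, `k = 5`, and the numerical bounds for both constants
      ∃ a b : ℝ,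
        a = (AztecDiamond.lam 10 / AztecDiamond.lam 8) ^ ((1 : ℝ) / 2) ∧
        b = AztecDiamond.xi 10 ^ ((1 : ℝ) / 10) ∧
        a ∈ Set.Ico (2.259132578 : ℝ) 2.259132579 ∧
        b ∈ Set.Ico (2.259154406 : ℝ) 2.259154407 ∧
        L ∈ Set.Icc a b ∧
        Real.sqrt a ∈ Set.Ico (1.503041110 : ℝ) 1.503041111 ∧
        Real.sqrt b ∈ Set.Ico (1.503048371 : ℝ) 1.503048372 ∧
        η ∈ Set.Icc (Real.sqrt a) (Real.sqrt b) := by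
  open AztecDiamond in
  obtain ⟨l, hl⟩ := cauchySeq_tendsto_of_complete cauchySeq_logRate
  have hη : Real.exp (l / 2) = Real.sqrt (Real.exp l) := Real.exp_half l
  have hlow := fun p q (hp : 1 ≤ p) => lam_div_rpow_le hl q hp
  have hup := fun k (hk : 1 ≤ k) => exp_le_xi_rpow hl (k := 2 * k) (by omega)
  have ha := lam_ratio_rpow_mem_Ico
  have hb := xi_rpow_mem_Ico
  have hLa : (lam 10 / lam 8) ^ ((1 : ℝ) / 2) ≤ Real.exp l := by
    simpa using hlow 2 4 (by norm_num)
  have hLb : Real.exp l ≤ xi 10 ^ ((1 : ℝ) / 10) := by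
    simpa using hup 5 (by norm_num)
  refine ⟨transferMatrix_isSymm, numIndepSets_eq_sum, numVertices_eq, Real.exp l,
    Real.exp (l / 2), tendsto_numIndepSets_rpow hl, tendsto_numIndepSets_rpow_numVertices hl, hη,
    hlow, hup, _, _, rfl, rfl,
    ⟨le_trans (by norm_num) ha.1, ha.2⟩, hb, ⟨hLa, hLb⟩, ⟨?_, ?_⟩, ⟨?_, ?_⟩, ?_⟩
  · exact Real.le_sqrt_of_sq_le (le_trans (by norm_num) ha.1)
  · rw [Real.sqrt_lt' (by norm_num)]
    exact ha.2.trans_le (by norm_num)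
  · exact Real.le_sqrt_of_sq_le (le_trans (by norm_num) hb.1)
  · rw [Real.sqrt_lt' (by norm_num)]
    exact hb.2.trans_le (by norm_num)
  · rw [hη]
    exact ⟨Real.sqrt_le_sqrt hLa, Real.sqrt_le_sqrt hLb⟩
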